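/- There is a universal constant $c>0$ with the following property. Let $d\in\mathbb N$, let $\mathcal X\subset\mathbb R^d$ be a nonempty set of measurement vectors, let $\mathcal Z\subset\mathbb R^d$ be a set of items, and let $\delta\in(0,1/8)$. A non-interactive (oracle) MLE procedure fixes, for every parameter $\theta\in\mathbb R^d$, a finite sequence $x_1,\dots,x_{T}\in\mathcal X$, where both the number of samples $T=T(\theta)$ and the $x_t$ may depend on $\theta$. It observes independent $y_t\sim\mathcal N(\langle x_t,\theta\rangle,1)$, $1\le t\le T$, forms the maximum likelihood estimate $\widehat\theta\in\arg\min_{\theta'\in\mathbb R^d}\sum_{t=1}^{T}(y_t-\langle x_t,\theta'\rangle)^2$ and outputs $\widehat z=\arg\max_{z\in\mathcal Z}\langle z,\widehat\theta\rangle$. The output is $z$ if $\arg\max_{\mathcal Z}\langle\cdot,\widehat\theta\rangle=\{z\}$; if the minimizer $\widehat\theta$ is not unique, this is required for every minimizer. The procedure is $\delta$-PAC for $(\mathcal X,\mathcal Z,\mathbb R^d)$ if, for every $\theta\in\mathbb R^d$ for which $\arg\max_{z\in\mathcal Z}\langle z,\theta\rangle=\{z_*\}$ is a single point, it outputs $z_*$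 with probability at least $1-\delta$. Suppose that a non-interactive MLE procedure is $\delta$-PAC for $(\mathcal X,\mathcal Z,\mathbb R^d)$, and let $\theta\in\mathbb R^d$ be such that $\arg\max_{z\in\mathcal Z}\langle z,\theta\rangle=\{z_*\}$. Then the number of samples that it uses on the instance $(\mathcal X,\mathcal Z,\theta)$ satisfies $$T(\theta)\ \ge\ c\,\bigl(\gamma^*+\rho^*\log(1/\delta)\bigr).$$ Here, with $\lambda$ ranging over the finitely supported probability weights on $\mathcal X$ and $A(\lambda)=\sum_{x}\lambda_x xx^\top$, $$\rho^*=\inf_{\lambda}\ \sup_{z\in\mathcal Z\setminus\{z_*\}}\frac{\|z_*-z\|^2_{A(\lambda)^{-1}}}{\langle\theta,z_*-z\rangle^2},\qquad \gamma^*=\inf_{\lambda}\ \Bigl(\mathbb E_{\eta\sim\mathcal N(0,I_d)}\Bigl[\sup_{z\in\mathcal Z\setminus\{z_*\}}\frac{(z_*-z)^\top A(\lambda)^{-1/2}\eta}{\theta^\top(z_*-z)}\Bigr]\Bigr)^{2},$$ where $\|v\|^2_{A^{-1}}=v^\top A^{-1}v$. For singular $A(\lambda)$, the inverse and its square root are taken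 on the range of $A(\lambda)$, and the quantity under the infimum is $+\infty$ if some $z_*-z$, $z\in\mathcal Z$, does not lie in this range. If $\mathcal Z=\{z_*\}$, both quantities are $0$. -/

import Mathlib

open MeasureTheory ProbabilityTheory
open scoped ENNReal

noncomputable section

namespace TransductiveBandit

/-- `ℝ^d` with its Euclidean structure. -/
abbrev Vec (d : ℕ) : Type := EuclideanSpace ℝ (Fin d)

variable {d : ℕ}

/-- The set `argmax_{z ∈ Z} ⟨z, w⟩`. -/
def argmaxSet (Z : Set (Vec d)) (w : Vec d) : Set (Vec d) :=
  {z | z ∈ Z ∧ ∀ z' ∈ Z, inner ℝ z' w ≤ inner ℝ z w}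

/-! ### The non-interactive MLE procedure -/

/-- A fixed finite sequence of measurement vectors from `X`, chosen before any data is seen. -/
structure Allocation (X : Set (Vec d)) where
  /-- the number of samples -/
  n : ℕ
  /-- the measurement vectors, in order, repetitions allowed -/
  x : Fin n → Vec d
  mem : ∀ t, x t ∈ X

/-- The joint law of the independent observations `y_t ~ N(⟨x_t, θ⟩, 1)`. -/
def obsLaw {X : Set (Vec d)} (a : Allocation X) (θ : Vec d) : Measure (Fin a.n → ℝ) :=
  Measure.pi fun t => gaussianReal (inner ℝ (a.x t) θ) 1

/-- The maximum likelihood (least squares) estimates from the observations `y`. This is always a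
nonempty set; it is a single point exactly when the measurement vectors span `ℝ^d`. -/
def mleSet {X : Set (Vec d)} (a : Allocation X) (y : Fin a.n → ℝ) : Set (Vec d) :=
  {θhat | ∀ θ' : Vec d,
    ∑ t, (y t - inner ℝ (a.x t) θhat) ^ 2 ≤ ∑ t, (y t - inner ℝ (a.x t) θ') ^ 2}

/-- The event that the procedure outputs `zs`: under the maximum likelihood estimate, `zs` is the
only maximizer over `Z`. If the estimate is not unique, this is required of all estimates, so that
the output does not depend on which one is taken. -/
def outputEvent {X : Set (Vec d)} (a : Allocation X) (Z : Set (Vec d)) (zs : Vec d) :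
    Set (Fin a.n → ℝ) :=
  {y | ∀ θhat ∈ mleSet a y, argmaxSet Z θhat = {zs}}

/-- The non-interactive MLE that uses the allocation `alloc θ` when the parameter is `θ` is
`δ`-PAC for `(X, Z, Θ)`: for all `θ ∈ Θ` with a unique best item, it outputs this item with
probability at least `1 - δ`. -/
def IsPAC (δ : ℝ) (X Z Θ : Set (Vec d)) (alloc : Vec d → Allocation X) : Prop :=
  ∀ θ ∈ Θ, ∀ zs : Vec d, argmaxSet Z θ = {zs} →
    ENNReal.ofReal (1 - δ) ≤ obsLaw (alloc θ) θ (outputEvent (alloc θ) Z zs)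

/-! ### The quantities `ρ*` and `γ*` -/

/-- The simplex over `X`: finitely supported probability weights on `X`. -/
def designs (X : Set (Vec d)) : Set (Vec d →₀ ℝ) :=
  {w | (∀ x ∈ w.support, x ∈ X) ∧ (∀ x, 0 ≤ w x) ∧ (w.sum fun _ p => p) = 1}

/-- `A(λ) = ∑ₓ λₓ x xᵀ`. -/
def designMatrix (w : Vec d →₀ ℝ) : Matrix (Fin d) (Fin d) ℝ :=
  w.sum fun x p => p • Matrix.vecMulVec x.ofLp x.ofLp

/-- `A⁻¹` for positive semidefinite `A`, by functional calculus. For singular `A` it is the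
inverse on the range of `A` and zero on the kernel (as `0⁻¹ = 0`); it is used below only
on vectors in the range. -/
def psdInv (A : Matrix (Fin d) (Fin d) ℝ) : Matrix (Fin d) (Fin d) ℝ :=
  cfc (fun t : ℝ => t⁻¹) A

/-- `A^{-1/2}` for positive semidefinite `A`, with the same convention for singular `A`. -/
def psdInvSqrt (A : Matrix (Fin d) (Fin d) ℝ) : Matrix (Fin d) (Fin d) ℝ :=
  cfc (fun t : ℝ => (√t)⁻¹) A

open scoped Classical in
/-- `‖v‖²_{A⁻¹} = vᵀ A⁻¹ v`, which is `∞` if `v` is not in the range of `A`. -/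
def invNormSq (A : Matrix (Fin d) (Fin d) ℝ) (v : Vec d) : ℝ≥0∞ :=
  if v ∈ LinearMap.range (Matrix.toEuclideanLin A) then
    ENNReal.ofReal (inner ℝ v (Matrix.toEuclideanLin (psdInv A) v))
  else ⊤

/-- `ρ*(λ) = sup_{z ∈ Z \ {z*}} ‖z* - z‖²_{A(λ)⁻¹} / ⟨θ, z* - z⟩²`. -/
def rho (Z : Set (Vec d)) (θ zs : Vec d) (w : Vec d →₀ ℝ) : ℝ≥0∞ :=
  ⨆ z ∈ Z \ {zs},
    invNormSq (designMatrix w) (zs - z) / ENNReal.ofReal (inner ℝ θ (zs - z) ^ 2)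

/-- `ρ* = inf_λ ρ*(λ)`. -/
def rhoStar (X Z : Set (Vec d)) (θ zs : Vec d) : ℝ≥0∞ :=
  ⨅ w ∈ designs X, rho Z θ zs w

/-- `sup_{z ∈ Z \ {z*}} (z* - z)ᵀ A(λ)^{-1/2} η / θᵀ(z* - z)`, in `[-∞, ∞]`. -/
def gaussSup (Z : Set (Vec d)) (θ zs : Vec d) (w : Vec d →₀ ℝ) (η : Vec d) : EReal :=
  ⨆ z ∈ Z \ {zs},
    ((inner ℝ (zs - z) (Matrix.toEuclideanLin (psdInvSqrt (designMatrix w)) η)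
      / inner ℝ θ (zs - z) : ℝ) : EReal)

/-- `E_{η ~ N(0, I)}` of the previous supremum, as the integral of the positive part minus the
integral of the negative part. For `Z \ {z*}` nonempty the supremum is at least a centred
Gaussian variable, so the second integral is finite and the difference is in `[0, ∞]`. For
`Z = {z*}` the value is `0`. -/
def gaussWidth (Z : Set (Vec d)) (θ zs : Vec d) (w : Vec d →₀ ℝ) : ℝ≥0∞ :=
  (∫⁻ η, (gaussSup Z θ zs w η).toENNReal ∂(stdGaussian (Vec d)))
    - ∫⁻ η, (-gaussSup Z θ zs w η).toENNReal ∂(stdGaussian (Vec d))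

open scoped Classical in
/-- `γ*(λ)`, the square of the expected supremum; it is `∞` if `A(λ)` is singular and some
`z* - z` is not in its range. -/
def gamma (Z : Set (Vec d)) (θ zs : Vec d) (w : Vec d →₀ ℝ) : ℝ≥0∞ :=
  if ∀ z ∈ Z, zs - z ∈ LinearMap.range (Matrix.toEuclideanLin (designMatrix w)) then
    gaussWidth Z θ zs w ^ 2
  else ⊤

/-- `γ* = inf_λ γ*(λ)`. -/
def gammaStar (X Z : Set (Vec d)) (θ zs : Vec d) : ℝ≥0∞ :=
  ⨅ w ∈ designs X, gamma Z θ zs w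

end TransductiveBandit

end

/-!
If the procedure outputs `zs` for some observations, then every `zs - z` is orthogonal to all
directions that the measurements do not see, hence lies in the range of the empirical design
matrix `A`. The least squares estimate may then be replaced by one whose error is
`N(0, A⁻¹ / n)`, and `zs` wins against all `z` only if the Gaussian process
`⟨A^{-1/2} (zs - z) / ⟨θ, zs - z⟩, η⟩`, indexed by `z`, stays above `-√n`. This event therefore has
probability at least `1 - δ`. The lower tail at a single `z` gives `ρ*(A) log (1 / δ) ≲ n`.
For `γ*`, the symmetry of `η` turns the one-sided bound into a two-sided one, of probability at
least `1 - 2δ ≥ 3/4`, and Fernique's theorem bounds the expected supremum of a Gaussian process that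
is at most `√n` in absolute value with probability `3/4` by a universal multiple of `√n`.
-/

noncomputable section

namespace TransductiveBandit

/-! ### Suprema of Gaussian processes -/

section Fernique

/-- A bound for `𝔼 ‖x‖ / a` under a measure for which the ball of radius `a` has measure at
least `c`: the bound of Fernique's theorem on `𝔼 exp (C (‖x‖ / a) ^ 2)`, where `C = logRatio c`,
divided by `√C`. -/
def ferniqueConst (c : ℝ≥0∞) : ℝ≥0∞ :=
  (ENNReal.ofReal (Real.exp (Fernique.logRatio c))
    + ∑' n : ℕ, ENNReal.ofReal (Real.exp (-2⁻¹ * Real.log (c / (1 - c)).toReal * 2 ^ n)))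
    / ENNReal.ofReal √(Fernique.logRatio c)

lemma ferniqueConst_lt_top {c : ℝ≥0∞} (hc : 2⁻¹ < c) (hc' : c < 1) : ferniqueConst c < ∞ := by
  have hodds : 1 < (c / (1 - c)).toReal := by
    have htwo : 1 < c + c := by
      rwa [← two_mul, mul_comm, ← ENNReal.div_lt_iff (by simp) (by simp), one_div]
    have hlt : 1 - c < c := ENNReal.sub_lt_of_lt_add hc'.le htwo
    rw [← ENNReal.toReal_one, ENNReal.toReal_lt_toReal ENNReal.one_ne_top
      (ENNReal.div_ne_top (by finiteness) (tsub_pos_of_lt hc').ne'),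
      ENNReal.lt_div_iff_mul_lt (.inl (tsub_pos_of_lt hc').ne') (.inl (by finiteness)), one_mul]
    exact hlt
  have hsum : Summable fun n : ℕ => Real.exp (-2⁻¹ * Real.log (c / (1 - c)).toReal * 2 ^ n) :=
    Real.summable_exp_nat_mul_of_ge
      (mul_neg_of_neg_of_pos (by norm_num) (Real.log_pos hodds))
      fun n => mod_cast n.lt_two_pow_self.le
  have hC := Real.sqrt_pos.2 (Fernique.logRatio_pos hc hc')
  exact ENNReal.div_lt_top
    (ENNReal.add_ne_top.2 ⟨ENNReal.ofReal_ne_top, hsum.tsum_ofReal_ne_top⟩)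
    (ENNReal.ofReal_pos.2 hC).ne'

variable {E : Type*} [MeasurableSpace E] {μ : Measure E} {ι : Type*}

lemma lintegral_enorm_le_mul_ferniqueConst [SeminormedAddCommGroup E] [NormedSpace ℝ E]
    [SecondCountableTopology E] [BorelSpace E] [IsProbabilityMeasure μ]
    (hrot : (μ.prod μ).map (ContinuousLinearMap.rotation (-(Real.pi / 4))) = μ.prod μ)
    {c : ℝ≥0∞} (hc : 2⁻¹ < c) (hc' : c < 1) {a : ℝ} (ha : 0 < a) (hμ : c ≤ μ {x | ‖x‖ ≤ a}) :
    ∫⁻ x, ‖x‖ₑ ∂μ ≤ ENNReal.ofReal a * ferniqueConst c := by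
  set C := Fernique.logRatio c
  have hC : 0 < √C := Real.sqrt_pos.2 (Fernique.logRatio_pos hc hc')
  have hexp (x : E) : √C * a⁻¹ * ‖x‖ ≤ Real.exp (C * a⁻¹ ^ 2 * ‖x‖ ^ 2) := by
    set t := √C * a⁻¹ * ‖x‖
    have ht : C * a⁻¹ ^ 2 * ‖x‖ ^ 2 = t ^ 2 := by
      rw [mul_pow, mul_pow, Real.sq_sqrt (Real.sqrt_pos.1 hC).le]
    rw [ht]
    nlinarith [Real.add_one_le_exp (t ^ 2), sq_nonneg (t - 1)]
  have henorm (x : E) : ‖x‖ₑ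
      = ENNReal.ofReal (a / √C) * ENNReal.ofReal (√C * a⁻¹ * ‖x‖) := by
    rw [← ENNReal.ofReal_mul (by positivity), ← ofReal_norm]
    congr 1
    field_simp
  calc ∫⁻ x, ‖x‖ₑ ∂μ
      = ENNReal.ofReal (a / √C) * ∫⁻ x, ENNReal.ofReal (√C * a⁻¹ * ‖x‖) ∂μ := by
        rw [← lintegral_const_mul' _ _ ENNReal.ofReal_ne_top]
        exact lintegral_congr henorm
    _ ≤ ENNReal.ofReal (a / √C)
          * ∫⁻ x, ENNReal.ofReal (Real.exp (C * a⁻¹ ^ 2 * ‖x‖ ^ 2)) ∂μ := by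
        gcongr with x
        exact hexp x
    _ ≤ ENNReal.ofReal a * ferniqueConst c := by
        rw [ENNReal.ofReal_div_of_pos hC, ferniqueConst, mul_div_assoc', ENNReal.mul_div_right_comm]
        gcongr
        exact lintegral_exp_mul_sq_norm_le_of_map_rotation_eq_self hrot hμ hc

variable [NormedAddCommGroup E] [NormedSpace ℝ E] [BorelSpace E] [SecondCountableTopology E]
  [CompleteSpace E] [IsGaussian μ] {c : ℝ≥0∞} {r : ℝ}

lemma lintegral_iSup_enorm_le_of_finite [Finite ι] (hμ₀ : μ[id] = 0) (hc : 2⁻¹ < c) (hc' : c < 1)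
    (hr : 0 < r) (L : ι → StrongDual ℝ E) (hL : c ≤ μ {x | ∀ i, ‖L i x‖ ≤ r}) :
    ∫⁻ x, ⨆ i, ‖L i x‖ₑ ∂μ ≤ ENNReal.ofReal r * ferniqueConst c := by
  have := Fintype.ofFinite ι
  set f : E →L[ℝ] (ι → ℝ) := ContinuousLinearMap.pi L
  have henorm (x : E) : ⨆ i, ‖L i x‖ₑ = ‖f x‖ₑ := by
    rw [enorm_eq_nnnorm, Pi.nnnorm_def, Finset.apply_sup_eq_sup_comp_of_linearOrder _
      ENNReal.coe_mono rfl, Finset.sup_univ_eq_iSup]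
    rfl
  have hmean : (μ.map f)[id] = 0 := by
    rw [integral_map (by fun_prop) (by fun_prop)]
    exact (f.integral_comp_comm IsGaussian.integrable_id).trans
      ((congrArg f hμ₀).trans (map_zero f))
  calc ∫⁻ x, ⨆ i, ‖L i x‖ₑ ∂μ = ∫⁻ y, ‖y‖ₑ ∂(μ.map f) := by
        rw [lintegral_map (by fun_prop) (by fun_prop)]
        exact lintegral_congr henorm
    _ ≤ ENNReal.ofReal r * ferniqueConst c := by
        refine lintegral_enorm_le_mul_ferniqueConst (IsGaussian.map_rotation_eq_self hmean _)
          hc hc' hr ?_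
        rw [Measure.map_apply (by fun_prop) (measurableSet_le (by fun_prop) (by fun_prop))]
        simpa [f, pi_norm_le_iff_of_nonneg hr.le] using hL

lemma lintegral_iSup_enorm_le_of_countable [Countable ι] (hμ₀ : μ[id] = 0) (hc : 2⁻¹ < c)
    (hc' : c < 1) (hr : 0 < r) (L : ι → StrongDual ℝ E) (hL : c ≤ μ {x | ∀ i, ‖L i x‖ ≤ r}) :
    ∫⁻ x, ⨆ i, ‖L i x‖ₑ ∂μ ≤ ENNReal.ofReal r * ferniqueConst c := by
  simp_rw [iSup_eq_iSup_finset (fun i => ‖L i _‖ₑ)]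
  rw [lintegral_iSup_directed (fun s => by fun_prop)
    (Monotone.directed_le fun s t hst x => biSup_mono fun i hi => Finset.mem_of_subset hst hi)]
  refine iSup_le fun s => ?_
  simp_rw [iSup_subtype']
  exact lintegral_iSup_enorm_le_of_finite hμ₀ hc hc' hr (fun i : s => L i)
    (hL.trans (measure_mono fun x hx i => hx i))

theorem lintegral_iSup_enorm_le [SecondCountableTopology (StrongDual ℝ E)] (hμ₀ : μ[id] = 0)
    (hc : 2⁻¹ < c) (hc' : c < 1) (hr : 0 < r) (L : ι → StrongDual ℝ E)
    (hL : c ≤ μ {x | ∀ i, ‖L i x‖ ≤ r}) :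
    ∫⁻ x, ⨆ i, ‖L i x‖ₑ ∂μ ≤ ENNReal.ofReal r * ferniqueConst c := by
  obtain ⟨T, hTL, hT, hLT⟩ :=
    (TopologicalSpace.IsSeparable.of_separableSpace (Set.range L)).exists_countable_dense_subset
  have hle (x : E) : ⨆ i, ‖L i x‖ₑ ≤ ⨆ ℓ : T, ‖(ℓ : StrongDual ℝ E) x‖ₑ := by
    have hclosed : IsClosed {l : StrongDual ℝ E | ‖l x‖ₑ ≤ ⨆ ℓ : T, ‖(ℓ : StrongDual ℝ E) x‖ₑ} :=
      isClosed_le (by fun_prop) continuous_const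
    have hT_le : T ⊆ {l | ‖l x‖ₑ ≤ ⨆ ℓ : T, ‖(ℓ : StrongDual ℝ E) x‖ₑ} :=
      fun l hl => le_iSup (fun ℓ : T => ‖(ℓ : StrongDual ℝ E) x‖ₑ) ⟨l, hl⟩
    exact iSup_le fun i => closure_minimal hT_le hclosed (hLT ⟨i, rfl⟩)
  have := hT.to_subtype
  refine (lintegral_mono hle).trans
    (lintegral_iSup_enorm_le_of_countable hμ₀ hc hc' hr _ (hL.trans (measure_mono ?_)))
  rintro x hx ⟨ℓ, hℓ⟩
  obtain ⟨i, rfl⟩ := hTL hℓ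
  exact hx i

end Fernique

section Symmetry

lemma two_mul_measure_le_one_add_measure_inter_neg {G : Type*} [MeasurableSpace G]
    [InvolutiveNeg G] [MeasurableNeg G] {μ : Measure G} [IsProbabilityMeasure μ]
    [μ.IsNegInvariant] {s : Set G} (hs : MeasurableSet s) :
    2 * μ s ≤ 1 + μ (s ∩ Neg.neg ⁻¹' s) := by
  calc 2 * μ s = μ s + μ (Neg.neg ⁻¹' s) := by rw [Measure.measure_preimage_neg, two_mul]
    _ = μ (s ∪ Neg.neg ⁻¹' s) + μ (s ∩ Neg.neg ⁻¹' s) :=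
      (measure_union_add_inter s (measurable_neg hs)).symm
    _ ≤ 1 + μ (s ∩ Neg.neg ⁻¹' s) := by
      gcongr
      exact prob_le_one

lemma two_mul_measure_forall_neg_le_le {E : Type*} [NormedAddCommGroup E] [NormedSpace ℝ E]
    [MeasurableSpace E] [BorelSpace E] {μ : Measure E} [IsProbabilityMeasure μ]
    [μ.IsNegInvariant] {ι : Type*} (L : ι → StrongDual ℝ E) (r : ℝ) :
    2 * μ {x | ∀ i, -r ≤ L i x} ≤ 1 + μ {x | ∀ i, ‖L i x‖ ≤ r} := by
  have hclosed : IsClosed {x | ∀ i, -r ≤ L i x} := by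
    simp only [Set.ofPred_forall]
    exact isClosed_iInter fun i => isClosed_le continuous_const (by fun_prop)
  have hinter : {x | ∀ i, -r ≤ L i x} ∩ Neg.neg ⁻¹' {x | ∀ i, -r ≤ L i x}
      = {x | ∀ i, ‖L i x‖ ≤ r} := by
    ext x
    simp [abs_le, forall_and]
  rw [← hinter]
  exact two_mul_measure_le_one_add_measure_inter_neg hclosed.measurableSet

end Symmetry

section StdGaussian

variable {E F G : Type*} [NormedAddCommGroup E] [InnerProductSpace ℝ E] [FiniteDimensional ℝ E]
  [MeasurableSpace E] [BorelSpace E]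

instance : (stdGaussian E).IsNegInvariant :=
  ⟨stdGaussian_map (LinearIsometryEquiv.neg ℝ)⟩

lemma inv_two_lt_three_div_four : (2⁻¹ : ℝ≥0∞) < 3 / 4 := by
  rw [← ENNReal.toReal_lt_toReal (by finiteness) (by finiteness)]
  norm_num

lemma three_div_four_lt_one : (3 / 4 : ℝ≥0∞) < 1 := by
  rw [← ENNReal.toReal_lt_toReal (by finiteness) (by finiteness)]
  norm_num

lemma lintegral_iSup_enorm_inner_le_of_forall_neg_le {ι : Type*} (g : ι → E) {r : ℝ} (hr : 0 < r)
    (hg : 7 / 8 ≤ stdGaussian E {η | ∀ i, -r ≤ inner ℝ (g i) η}) :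
    ∫⁻ η, ⨆ i, ‖inner ℝ (g i) η‖ₑ ∂(stdGaussian E)
      ≤ ENNReal.ofReal r * ferniqueConst (3 / 4) := by
  have hsum : 1 + 3 / 4 = (2 * (7 / 8) : ℝ≥0∞) := by
    rw [← ENNReal.toReal_eq_toReal_iff' (by finiteness) (by finiteness),
      ENNReal.toReal_add (by finiteness) (by finiteness)]
    norm_num
  refine lintegral_iSup_enorm_le integral_id_stdGaussian inv_two_lt_three_div_four
    three_div_four_lt_one hr (fun i => innerSL ℝ (g i)) ?_
  refine (ENNReal.add_le_add_iff_left ENNReal.one_ne_top).1 (hsum.trans_le ?_)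
  calc 2 * (7 / 8) ≤ 2 * stdGaussian E {η | ∀ i, -r ≤ innerSL ℝ (g i) η} := by gcongr; exact hg
    _ ≤ 1 + stdGaussian E {η | ∀ i, ‖innerSL ℝ (g i) η‖ ≤ r} :=
      two_mul_measure_forall_neg_le_le _ r

variable [NormedAddCommGroup F] [InnerProductSpace ℝ F] [FiniteDimensional ℝ F]
  [MeasurableSpace F] [BorelSpace F] [NormedAddCommGroup G] [InnerProductSpace ℝ G]
  [FiniteDimensional ℝ G] [MeasurableSpace G] [BorelSpace G]

lemma charFun_map_stdGaussian (f : E →L[ℝ] G) (t : G) :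
    charFun ((stdGaussian E).map f) t
      = Complex.exp (-(inner ℝ t ((f ∘L f.adjoint) t) : ℝ) / 2) := by
  have hnorm : inner ℝ t ((f ∘L f.adjoint) t) = ‖f.adjoint t‖ ^ 2 := by
    rw [ContinuousLinearMap.comp_apply, ← ContinuousLinearMap.adjoint_inner_left,
      real_inner_self_eq_norm_sq]
  rw [hnorm, Complex.ofReal_pow, ← charFun_stdGaussian, charFun_apply, charFun_apply,
    integral_map (by fun_prop) (by fun_prop)]
  simp_rw [ContinuousLinearMap.adjoint_inner_right]

lemma map_stdGaussian_eq_map_stdGaussian {f : E →L[ℝ] G} {g : F →L[ℝ] G}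
    (h : f ∘L f.adjoint = g ∘L g.adjoint) : (stdGaussian E).map f = (stdGaussian F).map g := by
  refine Measure.ext_of_charFun (funext fun t => ?_)
  rw [charFun_map_stdGaussian, charFun_map_stdGaussian, h]

end StdGaussian

/-! ### Lower bounds for the tail of a Gaussian variable -/

section Tail

lemma gaussianPDF_add_one_le_gaussianReal_Ioi {u : ℝ} (hu : 0 ≤ u) :
    gaussianPDF 0 1 (u + 1) ≤ gaussianReal 0 1 (Set.Ioi u) := by
  have hanti {x : ℝ} (hx : x ∈ Set.Ioc u (u + 1)) :
      gaussianPDF 0 1 (u + 1) ≤ gaussianPDF 0 1 x := by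
    have hx0 : 0 ≤ x := hu.trans hx.1.le
    simp only [gaussianPDF, gaussianPDFReal, sub_zero]
    gcongr
    exact hx.2
  calc gaussianPDF 0 1 (u + 1) = ∫⁻ _ in Set.Ioc u (u + 1), gaussianPDF 0 1 (u + 1) := by simp
    _ ≤ ∫⁻ x in Set.Ioc u (u + 1), gaussianPDF 0 1 x :=
      setLIntegral_mono' measurableSet_Ioc fun x hx => hanti hx
    _ = gaussianReal 0 1 (Set.Ioc u (u + 1)) := (gaussianReal_apply 0 one_ne_zero _).symm
    _ ≤ gaussianReal 0 1 (Set.Ioi u) := measure_mono Set.Ioc_subset_Ioi_self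

lemma exp_neg_le_gaussianPDFReal (x : ℝ) :
    Real.exp (-(x ^ 2 / 2) - 1) ≤ gaussianPDFReal 0 1 x := by
  have hpi : √(2 * Real.pi) ≤ Real.exp 1 := by
    rw [Real.sqrt_le_left (Real.exp_pos _).le]
    nlinarith [Real.exp_one_gt_d9, Real.pi_lt_d2]
  rw [gaussianPDFReal, sub_eq_add_neg, Real.exp_add, mul_comm, Real.exp_neg 1]
  simp only [sub_zero, NNReal.coe_one, mul_one, neg_div]
  gcongr

lemma log_one_div_le_of_gaussianReal_Ioi_le {u δ : ℝ} (hu : 0 ≤ u) (hδ : 0 < δ) (hδ' : δ ≤ 1 / 8)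
    (h : gaussianReal 0 1 (Set.Ioi u) ≤ ENNReal.ofReal δ) :
    Real.log (1 / δ) ≤ 11 * u ^ 2 := by
  have hexp : Real.exp (-((u + 1) ^ 2 / 2) - 1) ≤ δ :=
    (exp_neg_le_gaussianPDFReal _).trans <| (ENNReal.ofReal_le_ofReal_iff hδ.le).1 <|
      (gaussianPDF_add_one_le_gaussianReal_Ioi hu).trans h
  have hlog_le : Real.log (1 / δ) ≤ (u + 1) ^ 2 / 2 + 1 := by
    rw [one_div, Real.log_inv]
    linarith [(Real.le_log_iff_exp_le hδ).2 hexp]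
  have hle_log : 3 * Real.log 2 ≤ Real.log (1 / δ) := by
    rw [← Nat.cast_ofNat, ← Real.log_pow]
    refine Real.log_le_log (by norm_num) ?_
    rw [le_div_comm₀ (by norm_num) hδ]
    exact hδ'.trans_eq (by norm_num)
  -- As `3 log 2 > 2`, the two bounds keep `u` away from `0`, so that `u ^ 2` absorbs the constants.
  have hu' : 0.46 ≤ u := by nlinarith [Real.log_two_gt_d9]
  nlinarith [sq_nonneg (u - 1)]

lemma norm_sq_mul_log_one_div_le {E : Type*} [NormedAddCommGroup E] [InnerProductSpace ℝ E]
    [FiniteDimensional ℝ E] [MeasurableSpace E] [BorelSpace E] {g : E} {r δ : ℝ} (hr : 0 ≤ r)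
    (hδ : 0 < δ) (hδ' : δ ≤ 1 / 8)
    (h : ENNReal.ofReal (1 - δ) ≤ stdGaussian E {η | -r ≤ inner ℝ g η}) :
    ‖g‖ ^ 2 * Real.log (1 / δ) ≤ 11 * r ^ 2 := by
  rcases eq_or_ne g 0 with rfl | hg
  · simpa using by positivity
  have hg₀ : 0 < ‖g‖ := norm_pos_iff.2 hg
  set v := -(‖g‖⁻¹ • g)
  have hlaw : (stdGaussian E).map (innerSL ℝ v) = gaussianReal 0 1 := by
    have hv : ‖v‖ = 1 := by simp [v, norm_smul, hg₀.ne']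
    rw [IsGaussian.map_eq_gaussianReal, integral_strongDual_stdGaussian, variance_dual_stdGaussian,
      innerSL_apply_norm, hv]
    simp
  have hcompl : innerSL ℝ v ⁻¹' Set.Ioi (r / ‖g‖) = {η | -r ≤ inner ℝ g η}ᶜ := by
    ext η
    have hval : innerSL ℝ v η = -inner ℝ g η / ‖g‖ := by
      simp [v, div_eq_inv_mul]
    rw [Set.mem_preimage, Set.mem_Ioi, hval, div_lt_div_iff_of_pos_right hg₀, Set.mem_compl_iff,
      Set.mem_ofPred_eq, not_le, lt_neg]
  have htail : gaussianReal 0 1 (Set.Ioi (r / ‖g‖)) ≤ ENNReal.ofReal δ := by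
    rw [← hlaw, Measure.map_apply (by fun_prop) measurableSet_Ioi, hcompl,
      prob_compl_eq_one_sub (isClosed_le continuous_const (by fun_prop)).measurableSet]
    refine (tsub_le_tsub_left h 1).trans ?_
    rw [← ENNReal.ofReal_one, ← ENNReal.ofReal_sub _ (by linarith), sub_sub_cancel]
  calc ‖g‖ ^ 2 * Real.log (1 / δ) ≤ ‖g‖ ^ 2 * (11 * (r / ‖g‖) ^ 2) := by
        gcongr
        exact log_one_div_le_of_gaussianReal_Ioi_le (by positivity) hδ hδ' htail
    _ = 11 * r ^ 2 := by field_simp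

end Tail

variable {d : ℕ}

local notation "opOf" => Matrix.toEuclideanCLM (n := Fin _) (𝕜 := ℝ)

/-! ### Inverses of positive semidefinite matrices -/

section PsdInv

variable {A : Matrix (Fin d) (Fin d) ℝ}

lemma isSelfAdjoint_psdInv (A : Matrix (Fin d) (Fin d) ℝ) : IsSelfAdjoint (psdInv A) :=
  cfc_predicate _ _

lemma isSelfAdjoint_psdInvSqrt (A : Matrix (Fin d) (Fin d) ℝ) : IsSelfAdjoint (psdInvSqrt A) :=
  cfc_predicate _ _

lemma psdInvSqrt_mul_psdInvSqrt (hA : A.PosSemidef) : psdInvSqrt A * psdInvSqrt A = psdInv A := by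
  have hcont (f : ℝ → ℝ) : ContinuousOn f (spectrum ℝ A) := A.finite_real_spectrum.continuousOn f
  rw [psdInvSqrt, psdInv, ← cfc_mul _ _ A (hcont _) (hcont _)]
  refine cfc_congr fun t ht => ?_
  have ht₀ : 0 ≤ t := (Matrix.posSemidef_iff_isHermitian_and_spectrum_nonneg.1 hA).2 ht
  rw [← mul_inv, Real.mul_self_sqrt ht₀]

lemma mul_psdInv_mul_self (hA : IsSelfAdjoint A) : A * psdInv A * A = A := by
  have hcont (f : ℝ → ℝ) : ContinuousOn f (spectrum ℝ A) := A.finite_real_spectrum.continuousOn f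
  calc A * psdInv A * A = cfc id A * cfc (·⁻¹) A * cfc id A := by rw [cfc_id ℝ A hA, psdInv]
    _ = cfc (fun t : ℝ => t * t⁻¹ * t) A := by
        rw [← cfc_mul _ _ A (hcont _) (hcont _), ← cfc_mul _ _ A (hcont _) (hcont _)]
        rfl
    _ = cfc id A := cfc_congr fun t _ => mul_inv_mul_cancel t
    _ = A := cfc_id ℝ A hA

lemma psdInv_mul_mul_psdInv (hA : IsSelfAdjoint A) : psdInv A * A * psdInv A = psdInv A := by
  have hcont (f : ℝ → ℝ) : ContinuousOn f (spectrum ℝ A) := A.finite_real_spectrum.continuousOn f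
  calc psdInv A * A * psdInv A = cfc (·⁻¹) A * cfc id A * cfc (·⁻¹) A := by
        rw [cfc_id ℝ A hA, psdInv]
    _ = cfc (fun t : ℝ => t⁻¹ * t * t⁻¹) A := by
        rw [← cfc_mul _ _ A (hcont _) (hcont _), ← cfc_mul _ _ A (hcont _) (hcont _)]
        rfl
    _ = psdInv A := cfc_congr fun t _ => by simpa using mul_inv_mul_cancel t⁻¹

lemma inner_toEuclideanCLM_comm (hA : IsSelfAdjoint A) (u v : Vec d) :
    inner ℝ (opOf A u) v = inner ℝ u (opOf A v) := by
  rw [← ContinuousLinearMap.adjoint_inner_right, (hA.map opOf).adjoint_eq]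

lemma norm_psdInvSqrt_sq (hA : A.PosSemidef) (v : Vec d) :
    ‖opOf (psdInvSqrt A) v‖ ^ 2 = inner ℝ v (opOf (psdInv A) v) := by
  rw [← real_inner_self_eq_norm_sq, inner_toEuclideanCLM_comm (isSelfAdjoint_psdInvSqrt A),
    ← mul_apply_eq_comp, ← map_mul, psdInvSqrt_mul_psdInvSqrt hA]

end PsdInv

/-! ### Designs -/

section Designs

variable {X : Set (Vec d)}

lemma posSemidef_designMatrix {w : Vec d →₀ ℝ} (hw : ∀ x, 0 ≤ w x) :
    (designMatrix w).PosSemidef :=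
  Matrix.posSemidef_sum _ fun x _ =>
    (by simpa using Matrix.posSemidef_vecMulVec_self_star x.ofLp :
      (Matrix.vecMulVec x.ofLp x.ofLp).PosSemidef).smul (hw x)

lemma single_mem_designs {x : Vec d} (hx : x ∈ X) : Finsupp.single x 1 ∈ designs X := by
  refine ⟨fun y hy => ?_, fun y => ?_, by simp⟩
  · rwa [Finset.mem_singleton.1 (Finsupp.support_single_subset hy)]
  · rw [Finsupp.single_apply]
    split_ifs <;> norm_num

namespace Allocation

/-- The design that weights each vector by the proportion of the samples taken there, the
empirical measure of the allocation. -/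
def empirical (a : Allocation X) : Vec d →₀ ℝ :=
  ∑ t, Finsupp.single (a.x t) (a.n : ℝ)⁻¹

variable (a : Allocation X)

lemma empirical_nonneg (x : Vec d) : 0 ≤ a.empirical x := by
  classical
  rw [empirical, Finsupp.finsetSum_apply]
  refine Finset.sum_nonneg fun t _ => ?_
  rw [Finsupp.single_apply]
  split_ifs <;> positivity

lemma empirical_mem_designs {a : Allocation X} (hn : a.n ≠ 0) : a.empirical ∈ designs X := by
  classical
  refine ⟨fun x hx => ?_, a.empirical_nonneg, ?_⟩
  · obtain ⟨t, -, ht⟩ := Finset.mem_biUnion.1 (Finsupp.support_finsetSum hx)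
    rw [Finset.mem_singleton.1 (Finsupp.support_single_subset ht)]
    exact a.mem t
  · rw [empirical, ← Finsupp.sum_finsetSum_index (fun _ => rfl) (fun _ _ _ => rfl)]
    simp [hn]

lemma posSemidef_designMatrix_empirical : (designMatrix a.empirical).PosSemidef :=
  posSemidef_designMatrix a.empirical_nonneg

lemma designMatrix_empirical :
    designMatrix a.empirical
      = ∑ t, (a.n : ℝ)⁻¹ • Matrix.vecMulVec (a.x t).ofLp (a.x t).ofLp := by
  rw [designMatrix, empirical, ← Finsupp.sum_finsetSum_index (fun _ => by simp)
    (fun _ _ _ => add_smul _ _ _)]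
  simp

/-- The matrix of the linear model, whose rows are the measurement vectors: the observations are
`measMap a θ` plus standard Gaussian noise. -/
def measMap (a : Allocation X) : Vec d →L[ℝ] EuclideanSpace ℝ (Fin a.n) :=
  (EuclideanSpace.equiv (Fin a.n) ℝ).symm ∘L ContinuousLinearMap.pi fun t => innerSL ℝ (a.x t)

@[simp]
lemma measMap_apply (θ : Vec d) (t : Fin a.n) : a.measMap θ t = inner ℝ (a.x t) θ := rfl

lemma adjoint_measMap_comp_measMap :
    a.measMap.adjoint ∘L a.measMap = (a.n : ℝ) • opOf (designMatrix a.empirical) := by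
  refine ContinuousLinearMap.ext fun v => ext_inner_left ℝ fun u => ?_
  have hrow (t : Fin a.n) : inner ℝ u (opOf (Matrix.vecMulVec (a.x t).ofLp (a.x t).ofLp) v)
      = inner ℝ (a.x t) u * inner ℝ (a.x t) v := by
    rw [Matrix.inner_toEuclideanCLM, Matrix.vecMulVec_mulVec]
    simp [EuclideanSpace.inner_eq_star_dotProduct, dotProduct_smul, dotProduct_comm, mul_comm]
  rw [ContinuousLinearMap.comp_apply, ContinuousLinearMap.adjoint_inner_right, PiLp.inner_apply,
    designMatrix_empirical]
  simp only [map_sum, map_smul, smul_apply, sum_apply,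
    inner_smul_right, inner_sum, hrow, Finset.mul_sum]
  refine Finset.sum_congr rfl fun t _ => ?_
  have hn : (a.n : ℝ) ≠ 0 := by exact_mod_cast t.pos.ne'
  simp [hn, mul_comm]

end Allocation

end Designs

/-! ### Least squares -/

namespace Allocation

variable {X : Set (Vec d)} (a : Allocation X)

lemma sum_sq_sub_inner_eq_norm_sq (y : Fin a.n → ℝ) (θ : Vec d) :
    ∑ t, (y t - inner ℝ (a.x t) θ) ^ 2 = ‖WithLp.toLp 2 y - a.measMap θ‖ ^ 2 := by
  simp [EuclideanSpace.norm_sq_eq]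

variable {a}

lemma mem_mleSet_of_adjoint_measMap_sub_eq_zero {y : Fin a.n → ℝ} {θhat : Vec d}
    (h : a.measMap.adjoint (WithLp.toLp 2 y - a.measMap θhat) = 0) : θhat ∈ mleSet a y := by
  intro θ'
  rw [sum_sq_sub_inner_eq_norm_sq, sum_sq_sub_inner_eq_norm_sq]
  have horth : inner ℝ (WithLp.toLp 2 y - a.measMap θhat) (a.measMap (θhat - θ')) = 0 := by
    rw [← ContinuousLinearMap.adjoint_inner_left, h, inner_zero_left]
  calc ‖WithLp.toLp 2 y - a.measMap θhat‖ ^ 2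
      ≤ ‖WithLp.toLp 2 y - a.measMap θhat‖ ^ 2 + ‖a.measMap (θhat - θ')‖ ^ 2 :=
        le_add_of_nonneg_right (sq_nonneg _)
    _ = ‖(WithLp.toLp 2 y - a.measMap θhat) + a.measMap (θhat - θ')‖ ^ 2 := by
        rw [norm_add_sq_real, horth, mul_zero, add_zero]
    _ = ‖WithLp.toLp 2 y - a.measMap θ'‖ ^ 2 := by rw [map_sub, sub_add_sub_cancel]

lemma mleSet_nonempty (a : Allocation X) (y : Fin a.n → ℝ) : (mleSet a y).Nonempty := by
  set K := LinearMap.range a.measMap.toLinearMap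
  obtain ⟨θhat, hθhat⟩ : K.starProjection (WithLp.toLp 2 y) ∈ K := K.starProjection_apply_mem _
  refine ⟨θhat, mem_mleSet_of_adjoint_measMap_sub_eq_zero (ext_inner_right ℝ fun v => ?_)⟩
  have horth := K.sub_starProjection_mem_orthogonal (WithLp.toLp 2 y)
  rw [← hθhat] at horth
  rw [ContinuousLinearMap.adjoint_inner_left, inner_zero_left]
  exact K.inner_left_of_mem_orthogonal ⟨v, rfl⟩ horth

lemma add_mem_mleSet {y : Fin a.n → ℝ} {θhat k : Vec d} (hθhat : θhat ∈ mleSet a y)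
    (hk : a.measMap k = 0) : θhat + k ∈ mleSet a y := fun θ' => by
  simpa [sum_sq_sub_inner_eq_norm_sq, hk] using hθhat θ'

-- A direction `k` that the measurements do not see can be added to any estimate; if `zs - z` had
-- a component along `k`, some estimate would give `z` and `zs` the same value.
lemma sub_mem_ker_measMap_orthogonal {Z : Set (Vec d)} {zs z : Vec d} {y : Fin a.n → ℝ}
    (hy : y ∈ outputEvent a Z zs) (hz : z ∈ Z) :
    zs - z ∈ (LinearMap.ker a.measMap.toLinearMap)ᗮ := by
  rw [Submodule.mem_orthogonal']
  intro k hk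
  by_contra hne
  obtain ⟨θhat, hθhat⟩ := mleSet_nonempty a y
  set s := -(inner ℝ (zs - z) θhat / inner ℝ (zs - z) k)
  have htie : inner ℝ z (θhat + s • k) = inner ℝ zs (θhat + s • k) := by
    rw [eq_comm, ← sub_eq_zero, ← inner_sub_left, inner_add_right, inner_smul_right]
    simp [s, hne]
  have hargmax : argmaxSet Z (θhat + s • k) = {zs} :=
    hy _ (add_mem_mleSet hθhat (by rw [map_smul, show a.measMap k = 0 from hk, smul_zero]))
  have hzs : zs ∈ argmaxSet Z (θhat + s • k) := hargmax ▸ rfl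
  have hz' : z ∈ argmaxSet Z (θhat + s • k) := ⟨hz, fun z' hz' => htie ▸ hzs.2 z' hz'⟩
  rw [hargmax, Set.mem_singleton_iff] at hz'
  simp [hz'] at hne

lemma range_adjoint_measMap (hn : a.n ≠ 0) :
    LinearMap.range a.measMap.adjoint.toLinearMap
      = LinearMap.range (Matrix.toEuclideanLin (designMatrix a.empirical)) := by
  have hn' : (a.n : ℝ) ≠ 0 := by exact_mod_cast hn
  calc LinearMap.range a.measMap.adjoint.toLinearMap
      = LinearMap.range (a.measMap.adjoint ∘L a.measMap).toLinearMap :=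
        (LinearMap.range_adjoint_comp_self a.measMap.toLinearMap).symm
    _ = LinearMap.range (Matrix.toEuclideanLin (designMatrix a.empirical)) := by
        rw [adjoint_measMap_comp_measMap]
        exact LinearMap.range_smul _ _ hn'

lemma orthogonal_ker_measMap (hn : a.n ≠ 0) :
    (LinearMap.ker a.measMap.toLinearMap)ᗮ
      = LinearMap.range (Matrix.toEuclideanLin (designMatrix a.empirical)) := by
  rw [← range_adjoint_measMap hn, ContinuousLinearMap.orthogonal_ker]
  exact (Submodule.closed_of_finiteDimensional _).submodule_topologicalClosure_eq

lemma sub_mem_range_designMatrix (hn : a.n ≠ 0) {Z : Set (Vec d)} {zs : Vec d}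
    {y : Fin a.n → ℝ} (hy : y ∈ outputEvent a Z zs) :
    ∀ z ∈ Z, zs - z ∈ LinearMap.range (Matrix.toEuclideanLin (designMatrix a.empirical)) :=
  fun _ hz => orthogonal_ker_measMap hn ▸ sub_mem_ker_measMap_orthogonal hy hz

/-- The error of a least squares estimate as a function of the noise `ε`, namely
`n⁻¹ A⁻¹ ∑ₜ εₜ xₜ` where `A` is the empirical design matrix. -/
def errorMap (a : Allocation X) : EuclideanSpace ℝ (Fin a.n) →L[ℝ] Vec d :=
  (a.n : ℝ)⁻¹ • (opOf (psdInv (designMatrix a.empirical)) ∘L a.measMap.adjoint)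

lemma add_errorMap_mem_mleSet (hn : a.n ≠ 0) (θ : Vec d) (ε : EuclideanSpace ℝ (Fin a.n)) :
    θ + a.errorMap ε ∈ mleSet a (a.measMap θ + ε).ofLp := by
  refine mem_mleSet_of_adjoint_measMap_sub_eq_zero ?_
  set B := opOf (designMatrix a.empirical)
  set P := opOf (psdInv (designMatrix a.empirical))
  have hn' : (a.n : ℝ) ≠ 0 := by exact_mod_cast hn
  obtain ⟨v, hv⟩ : ∃ v, B v = a.measMap.adjoint ε :=
    (range_adjoint_measMap hn).le ⟨ε, rfl⟩
  have hBPB : B * P * B = B := by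
    rw [← map_mul, ← map_mul, mul_psdInv_mul_self a.posSemidef_designMatrix_empirical.1]
  have hfix : a.measMap.adjoint (a.measMap (a.errorMap ε)) = a.measMap.adjoint ε :=
    calc a.measMap.adjoint (a.measMap (a.errorMap ε))
        = (a.n : ℝ) • B ((a.n : ℝ)⁻¹ • P (a.measMap.adjoint ε)) :=
          DFunLike.congr_fun a.adjoint_measMap_comp_measMap _
      _ = (B * P * B) v := by rw [map_smul, smul_inv_smul₀ hn', ← hv]; rfl
      _ = a.measMap.adjoint ε := by rw [hBPB, hv]
  rw [map_add, WithLp.toLp_ofLp, add_sub_add_left_eq_sub, map_sub, hfix, sub_self]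

/-! ### The law of the estimate -/

lemma obsLaw_eq_map_stdGaussian (a : Allocation X) (θ : Vec d) :
    obsLaw a θ = (stdGaussian (EuclideanSpace ℝ (Fin a.n))).map
      fun ε => (a.measMap θ + ε).ofLp := by
  have hshift (t : Fin a.n) : gaussianReal (inner ℝ (a.x t) θ) 1
      = (gaussianReal 0 1).map (inner ℝ (a.x t) θ + ·) := by
    rw [gaussianReal_map_const_add, zero_add]
  rw [← map_pi_eq_stdGaussian, Measure.map_map (by fun_prop) (by fun_prop), obsLaw]
  simp_rw [hshift]
  rw [← Measure.pi_map_pi fun t => by fun_prop]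
  rfl

lemma errorMap_comp_adjoint_errorMap (a : Allocation X) :
    a.errorMap ∘L a.errorMap.adjoint
      = (a.n : ℝ)⁻¹ • opOf (psdInv (designMatrix a.empirical)) := by
  set B := opOf (designMatrix a.empirical)
  set P := opOf (psdInv (designMatrix a.empirical))
  have hadj : a.errorMap.adjoint = (a.n : ℝ)⁻¹ • (a.measMap ∘L P) := by
    have hPadj : P.adjoint = P := ((isSelfAdjoint_psdInv _).map opOf).adjoint_eq
    rw [errorMap, map_smulₛₗ, ContinuousLinearMap.adjoint_comp, hPadj,
      ContinuousLinearMap.adjoint_adjoint, conj_trivial]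
  have hPBP : P * B * P = P := by
    rw [← map_mul, ← map_mul, psdInv_mul_mul_psdInv a.posSemidef_designMatrix_empirical.1]
  have hinv : (a.n : ℝ)⁻¹ * (a.n : ℝ)⁻¹ * a.n = (a.n : ℝ)⁻¹ := by
    simpa using mul_self_mul_inv (a.n : ℝ)⁻¹
  calc a.errorMap ∘L a.errorMap.adjoint
      = (a.n : ℝ)⁻¹ • (a.n : ℝ)⁻¹ • (P ∘L (a.measMap.adjoint ∘L a.measMap) ∘L P) := by
        rw [hadj, errorMap, ContinuousLinearMap.smul_comp, ContinuousLinearMap.comp_smul]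
        rfl
    _ = (a.n : ℝ)⁻¹ • (P * B * P) := by
        rw [adjoint_measMap_comp_measMap, ContinuousLinearMap.smul_comp,
          ContinuousLinearMap.comp_smul, smul_smul, smul_smul, hinv]
        rfl
    _ = (a.n : ℝ)⁻¹ • P := by rw [hPBP]

lemma map_errorMap_stdGaussian (a : Allocation X) :
    (stdGaussian (EuclideanSpace ℝ (Fin a.n))).map a.errorMap
      = (stdGaussian (Vec d)).map ((√a.n)⁻¹ • opOf (psdInvSqrt (designMatrix a.empirical))) := by
  refine map_stdGaussian_eq_map_stdGaussian ?_
  have hQ : (opOf (psdInvSqrt (designMatrix a.empirical))).adjoint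
      = opOf (psdInvSqrt (designMatrix a.empirical)) :=
    ((isSelfAdjoint_psdInvSqrt _).map opOf).adjoint_eq
  rw [errorMap_comp_adjoint_errorMap,
    ← psdInvSqrt_mul_psdInvSqrt a.posSemidef_designMatrix_empirical, map_mul, map_smulₛₗ,
    conj_trivial, hQ, ContinuousLinearMap.smul_comp, ContinuousLinearMap.comp_smul, smul_smul,
    ← mul_inv, Real.mul_self_sqrt a.n.cast_nonneg]
  rfl

end Allocation

/-! ### The lower bound -/

section LowerBound

variable {X Z : Set (Vec d)} {θ zs : Vec d} {w : Vec d →₀ ℝ}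

lemma inner_sub_pos (h : argmaxSet Z θ = {zs}) {z : Vec d} (hz : z ∈ Z \ {zs}) :
    0 < inner ℝ θ (zs - z) := by
  have hzs : zs ∈ argmaxSet Z θ := h ▸ rfl
  rw [inner_sub_right, sub_pos, real_inner_comm, real_inner_comm zs]
  refine lt_of_le_of_ne (hzs.2 z hz.1) fun heq => hz.2 ?_
  rw [← h]
  exact ⟨hz.1, fun z' hz' => heq ▸ hzs.2 z' hz'⟩

/-- The vector `A(w)^{-1/2} (zs - z) / ⟨θ, zs - z⟩`. Its squared norm is the ratio in `ρ*(w)`, and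
`⟨gapVec w θ zs z, η⟩` is the Gaussian process in `γ*(w)`. -/
def gapVec (w : Vec d →₀ ℝ) (θ zs z : Vec d) : Vec d :=
  (inner ℝ θ (zs - z))⁻¹ • opOf (psdInvSqrt (designMatrix w)) (zs - z)

lemma inner_gapVec (w : Vec d →₀ ℝ) (θ zs z η : Vec d) :
    inner ℝ (gapVec w θ zs z) η
      = inner ℝ (zs - z) (opOf (psdInvSqrt (designMatrix w)) η) / inner ℝ θ (zs - z) := by
  rw [gapVec, real_inner_smul_left, inner_toEuclideanCLM_comm (isSelfAdjoint_psdInvSqrt _),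
    inv_mul_eq_div]

lemma norm_gapVec_sq (hw : ∀ x, 0 ≤ w x) (θ zs z : Vec d) :
    ‖gapVec w θ zs z‖ ^ 2
      = inner ℝ (zs - z) (opOf (psdInv (designMatrix w)) (zs - z)) / inner ℝ θ (zs - z) ^ 2 := by
  rw [gapVec, norm_smul, mul_pow, norm_psdInvSqrt_sq (posSemidef_designMatrix hw), norm_inv,
    inv_pow, Real.norm_eq_abs, sq_abs, inv_mul_eq_div]

lemma rho_mul_log_le (hw : ∀ x, 0 ≤ w x) (h : argmaxSet Z θ = {zs})
    (hrange : ∀ z ∈ Z, zs - z ∈ LinearMap.range (Matrix.toEuclideanLin (designMatrix w)))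
    {δ r : ℝ} (hδ : 0 < δ) (hδ' : δ ≤ 1 / 8) (hr : 0 ≤ r)
    (hg : ENNReal.ofReal (1 - δ)
      ≤ stdGaussian (Vec d) {η | ∀ z : ↥(Z \ {zs}), -r ≤ inner ℝ (gapVec w θ zs z) η}) :
    rho Z θ zs w * ENNReal.ofReal (Real.log (1 / δ)) ≤ ENNReal.ofReal (11 * r ^ 2) := by
  simp only [rho, ENNReal.iSup_mul]
  refine iSup₂_le fun z hz => ?_
  have hgap := inner_sub_pos h hz
  have hlog : 0 ≤ Real.log (1 / δ) := Real.log_nonneg (by rw [le_div_iff₀ hδ]; linarith)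
  have htail : ‖gapVec w θ zs z‖ ^ 2 * Real.log (1 / δ) ≤ 11 * r ^ 2 :=
    norm_sq_mul_log_one_div_le hr hδ hδ' (hg.trans (measure_mono fun η hη => hη ⟨z, hz⟩))
  rw [norm_gapVec_sq hw] at htail
  rw [invNormSq, if_pos (hrange z hz.1), ← ENNReal.ofReal_div_of_pos (by positivity),
    ← ENNReal.ofReal_mul' hlog]
  exact ENNReal.ofReal_le_ofReal htail

lemma gaussWidth_le_lintegral_iSup_enorm (w : Vec d →₀ ℝ) :
    gaussWidth Z θ zs w
      ≤ ∫⁻ η, ⨆ z : ↥(Z \ {zs}), ‖inner ℝ (gapVec w θ zs z) η‖ₑ ∂(stdGaussian (Vec d)) := by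
  refine tsub_le_self.trans (lintegral_mono fun η => ?_)
  rw [← EReal.toENNReal_coe (x := ⨆ z : ↥(Z \ {zs}), ‖inner ℝ (gapVec w θ zs z) η‖ₑ)]
  refine EReal.toENNReal_le_toENNReal (iSup₂_le fun z hz => ?_)
  calc ((inner ℝ (zs - z) (opOf (psdInvSqrt (designMatrix w)) η) / inner ℝ θ (zs - z) : ℝ) : EReal)
      = (inner ℝ (gapVec w θ zs z) η : ℝ) := by rw [inner_gapVec]
    _ ≤ (‖inner ℝ (gapVec w θ zs z) η‖ : ℝ) := EReal.coe_le_coe (Real.le_norm_self _)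
    _ = (‖inner ℝ (gapVec w θ zs z) η‖ₑ : EReal) := by
      rw [← ofReal_norm, EReal.coe_ennreal_ofReal, max_eq_left (norm_nonneg _)]
    _ ≤ _ := EReal.coe_ennreal_le_coe_ennreal_iff.2
      (le_iSup (fun z : ↥(Z \ {zs}) => ‖inner ℝ (gapVec w θ zs z) η‖ₑ) ⟨z, hz⟩)

lemma gamma_le (hrange : ∀ z ∈ Z, zs - z ∈ LinearMap.range (Matrix.toEuclideanLin (designMatrix w)))
    {r : ℝ} (hr : 0 < r)
    (hg : 7 / 8
      ≤ stdGaussian (Vec d) {η | ∀ z : ↥(Z \ {zs}), -r ≤ inner ℝ (gapVec w θ zs z) η}) :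
    gamma Z θ zs w ≤ ferniqueConst (3 / 4) ^ 2 * ENNReal.ofReal (r ^ 2) := by
  rw [gamma, if_pos hrange, mul_comm, ENNReal.ofReal_pow hr.le, ← mul_pow]
  gcongr
  exact (gaussWidth_le_lintegral_iSup_enorm w).trans
    (lintegral_iSup_enorm_inner_le_of_forall_neg_le _ hr hg)

namespace Allocation

variable {a : Allocation X}

lemma add_errorMap_nonneg_of_mem_outputEvent (hn : a.n ≠ 0) {ε : EuclideanSpace ℝ (Fin a.n)}
    (hy : (a.measMap θ + ε).ofLp ∈ outputEvent a Z zs) {z : Vec d} (hz : z ∈ Z) :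
    0 ≤ inner ℝ (zs - z) (θ + a.errorMap ε) := by
  have hzs : zs ∈ argmaxSet Z (θ + a.errorMap ε) := hy _ (add_errorMap_mem_mleSet hn θ ε) ▸ rfl
  rw [inner_sub_left, sub_nonneg]
  exact hzs.2 z hz

lemma inner_sub_add_nonneg_iff (hn : a.n ≠ 0) (h : argmaxSet Z θ = {zs}) {z : Vec d}
    (hz : z ∈ Z \ {zs}) (η : Vec d) :
    0 ≤ inner ℝ (zs - z)
        (θ + ((√a.n)⁻¹ • opOf (psdInvSqrt (designMatrix a.empirical))) η)
      ↔ -√a.n ≤ inner ℝ (gapVec a.empirical θ zs z) η := by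
  have hgap := inner_sub_pos h hz
  have hn' : 0 < √(a.n : ℝ) := by positivity
  rw [inner_gapVec, le_div_iff₀ hgap, inner_add_right, real_inner_comm, smul_apply,
    inner_smul_right, ← mul_le_mul_iff_of_pos_left hn', mul_zero, mul_add,
    mul_inv_cancel_left₀ hn'.ne', neg_mul, neg_le_iff_add_nonneg']

lemma obsLaw_outputEvent_le (hn : a.n ≠ 0) (h : argmaxSet Z θ = {zs}) :
    obsLaw a θ (outputEvent a Z zs) ≤ stdGaussian (Vec d)
      {η | ∀ z : ↥(Z \ {zs}), -√a.n ≤ inner ℝ (gapVec a.empirical θ zs z) η} := by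
  set D : Set (Vec d) := {u | ∀ z : ↥(Z \ {zs}), 0 ≤ inner ℝ (zs - z) (θ + u)} with hD
  have hDm : MeasurableSet D := by
    refine IsClosed.measurableSet ?_
    simp only [hD, Set.ofPred_forall]
    exact isClosed_iInter fun z => isClosed_le continuous_const (by fun_prop)
  set noise : (Fin a.n → ℝ) → EuclideanSpace ℝ (Fin a.n) := fun y => WithLp.toLp 2 y - a.measMap θ
  have hsub : outputEvent a Z zs ⊆ (fun y => a.errorMap (noise y)) ⁻¹' D := fun y hy z =>
    add_errorMap_nonneg_of_mem_outputEvent hn (by simpa [noise] using hy) z.2.1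
  calc obsLaw a θ (outputEvent a Z zs)
      ≤ obsLaw a θ ((fun y => a.errorMap (noise y)) ⁻¹' D) := measure_mono hsub
    _ = (stdGaussian (EuclideanSpace ℝ (Fin a.n))).map a.errorMap D := by
        rw [obsLaw_eq_map_stdGaussian, Measure.map_apply (by fun_prop)
          (hDm.preimage (by fun_prop)), Measure.map_apply (by fun_prop) hDm]
        congr 1
        ext ε
        simp [noise]
    _ = stdGaussian (Vec d)
          {η | ∀ z : ↥(Z \ {zs}), -√a.n ≤ inner ℝ (gapVec a.empirical θ zs z) η} := by
        rw [map_errorMap_stdGaussian, Measure.map_apply (by fun_prop) hDm]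
        exact congrArg _ (Set.ext fun η =>
          forall_congr' fun z => inner_sub_add_nonneg_iff hn h z.2 η)

lemma eq_singleton_of_mem_outputEvent (hn : a.n = 0) {y : Fin a.n → ℝ}
    (hy : y ∈ outputEvent a Z zs) : Z = {zs} := by
  have : IsEmpty (Fin a.n) := by rw [hn]; infer_instance
  rw [← hy 0 fun θ' => by simp]
  ext z
  simp [argmaxSet]

lemma gamma_empirical_add_rho_empirical_mul_log_le (hn : a.n ≠ 0) {δ : ℝ} (hδ : 0 < δ)
    (hδ' : δ ≤ 1 / 8) (h : argmaxSet Z θ = {zs})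
    (hcorrect : ENNReal.ofReal (1 - δ) ≤ obsLaw a θ (outputEvent a Z zs)) :
    gamma Z θ zs a.empirical + rho Z θ zs a.empirical * ENNReal.ofReal (Real.log (1 / δ))
      ≤ (ferniqueConst (3 / 4) ^ 2 + 11) * a.n := by
  have hpos : 0 < √(a.n : ℝ) := by positivity
  have hsq : √(a.n : ℝ) ^ 2 = a.n := Real.sq_sqrt a.n.cast_nonneg
  obtain ⟨y, hy⟩ : (outputEvent a Z zs).Nonempty := nonempty_of_measure_ne_zero
    ((ENNReal.ofReal_pos.2 (by linarith)).trans_le hcorrect).ne'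
  have hrange := sub_mem_range_designMatrix hn hy
  have hg := hcorrect.trans (obsLaw_outputEvent_le hn h)
  have h78 : (7 / 8 : ℝ≥0∞) ≤ ENNReal.ofReal (1 - δ) := by
    rw [ENNReal.le_ofReal_iff_toReal_le (by finiteness) (by linarith)]
    norm_num
    linarith
  have hgamma := gamma_le hrange hpos (h78.trans hg)
  have hrho := rho_mul_log_le a.empirical_nonneg h hrange hδ hδ' hpos.le hg
  rw [hsq, ENNReal.ofReal_natCast] at hgamma
  rw [hsq, ENNReal.ofReal_mul (by norm_num), ENNReal.ofReal_natCast, ENNReal.ofReal_ofNat] at hrho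
  rw [add_mul]
  exact add_le_add hgamma hrho

end Allocation

lemma rhoStar_singleton (hX : X.Nonempty) : rhoStar X {zs} θ zs = 0 := by
  obtain ⟨x, hx⟩ := hX
  exact nonpos_iff_eq_zero.1 (iInf₂_le_of_le _ (single_mem_designs hx) (by simp [rho]))

lemma gammaStar_singleton (hX : X.Nonempty) : gammaStar X {zs} θ zs = 0 := by
  obtain ⟨x, hx⟩ := hX
  refine nonpos_iff_eq_zero.1 (iInf₂_le_of_le _ (single_mem_designs hx) ?_)
  rw [gamma, if_pos (by rintro z rfl; exact sub_self z ▸ zero_mem _)]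
  simp [gaussWidth, gaussSup]

lemma gammaStar_add_rhoStar_mul_log_le (hX : X.Nonempty) {a : Allocation X} {δ : ℝ} (hδ : 0 < δ)
    (hδ' : δ ≤ 1 / 8) (h : argmaxSet Z θ = {zs})
    (hcorrect : ENNReal.ofReal (1 - δ) ≤ obsLaw a θ (outputEvent a Z zs)) :
    gammaStar X Z θ zs + rhoStar X Z θ zs * ENNReal.ofReal (Real.log (1 / δ))
      ≤ (ferniqueConst (3 / 4) ^ 2 + 11) * a.n := by
  rcases eq_or_ne a.n 0 with hn | hn
  · obtain ⟨y, hy⟩ : (outputEvent a Z zs).Nonempty := nonempty_of_measure_ne_zero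
      ((ENNReal.ofReal_pos.2 (by linarith)).trans_le hcorrect).ne'
    rw [Allocation.eq_singleton_of_mem_outputEvent hn hy, gammaStar_singleton hX,
      rhoStar_singleton hX, zero_mul, add_zero]
    exact zero_le
  · have hmem := a.empirical_mem_designs hn
    exact (add_le_add (iInf₂_le _ hmem) (mul_le_mul_left (iInf₂_le _ hmem) _)).trans
      (Allocation.gamma_empirical_add_rho_empirical_mul_log_le hn hδ hδ' h hcorrect)

end LowerBound

end TransductiveBandit

end

open TransductiveBandit in
theorem theorem2_general :
    ∃ c : ℝ, 0 < c ∧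
      ∀ (d : ℕ) (X Z : Set (Vec d)) (_ : X.Nonempty) (δ : ℝ) (_ : 0 < δ) (_ : δ < 1 / 8)
        (a : Allocation X) (θ zs : Vec d) (_ : argmaxSet Z θ = {zs})
        (_ : ENNReal.ofReal (1 - δ) ≤ obsLaw a θ (outputEvent a Z zs)),
        ENNReal.ofReal c *
            (gammaStar X Z θ zs + rhoStar X Z θ zs * ENNReal.ofReal (Real.log (1 / δ)))
          ≤ (a.n : ENNReal) := by
  set K : ENNReal := ferniqueConst (3 / 4) ^ 2 + 11
  have hK : K ≠ 0 := by simp [K]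
  have hK' : K ≠ ⊤ := by
    have := ferniqueConst_lt_top inv_two_lt_three_div_four three_div_four_lt_one
    finiteness
  have hc : 0 < K.toReal := ENNReal.toReal_pos hK hK'
  refine ⟨K.toReal⁻¹, inv_pos.2 hc, fun d X Z hX δ hδ hδ' a θ zs hzs hcorrect => ?_⟩
  rw [ENNReal.ofReal_inv_of_pos hc, ENNReal.ofReal_toReal hK', ENNReal.inv_mul_le_iff hK hK']
  exact gammaStar_add_rhoStar_mul_log_le hX hδ hδ'.le hzs hcorrect

theorem theorem2 :
    ∃ c : ℝ, 0 < c ∧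
      ∀ (d : ℕ) (X Z : Set (TransductiveBandit.Vec d)) (_ : X.Nonempty)
        (δ : ℝ) (_ : 0 < δ) (_ : δ < 1 / 8)
        (alloc : TransductiveBandit.Vec d → TransductiveBandit.Allocation X)
        (_ : TransductiveBandit.IsPAC δ X Z Set.univ alloc)
        (θ zs : TransductiveBandit.Vec d)
        (_ : TransductiveBandit.argmaxSet Z θ = {zs}),
        ENNReal.ofReal c *
            (TransductiveBandit.gammaStar X Z θ zs
              + TransductiveBandit.rhoStar X Z θ zs * ENNReal.ofReal (Real.log (1 / δ)))
          ≤ ((alloc θ).n : ENNReal) := by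
  obtain ⟨c, hc, hbound⟩ := theorem2_general
  exact ⟨c, hc, fun d X Z hX δ hδ hδ' alloc hpac θ zs hzs =>
    hbound d X Z hX δ hδ hδ' (alloc θ) θ zs hzs (hpac θ (Set.mem_univ θ) zs hzs)⟩
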